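/- Theorem 2 (Global convergence of VOC). Consider a connected resistive network with inverter nodes $\mathcal N=\{1,\dots,N\}$ and internal nodes $\mathcal I$, with symmetric nonnegative line conductances, nonnegative shunt conductances, and sinusoidal current sources of frequency $\omega$ with current vector $i_{\mathcal I}$ at the internal nodes. Let $Q_{\mathcal A}=\begin{bmatrix}Q_{\mathcal{NN}}&Q_{\mathcal{NI}}\\Q_{\mathcal{NI}}^{\mathrm T}&Q_{\mathcal{II}}\end{bmatrix}$ be its conductance matrix (diagonal entries: shunt conductance plus the sum of the incident line conductances; off-diagonal entries: minus the line conductances), let $Q=Q_{\mathcal{NN}}-Q_{\mathcal{NI}}Q_{\mathcal{II}}^{-1}Q_{\mathcal{NI}}^{\mathrm T}$ be the Kron-reduced conductance matrix, and put $g_{jj}=[Q]_{jj}$, $g_{j\ell}=-[Q]_{j\ell}$ for $\ell\neq j$. Let $\iota_j\cos(\omega t+\gamma_j)$ with $\iota_j\ge 0$ be the $j$th entry of $Q_{\mathcal{NI}}Q_{\mathcal{II}}^{-1}i_{\mathcal I}$. Let $\alpha,k,C>0$ and $\kappa_j>0$ for $j\in\mathcal N$, and put $\beta=3k/\alpha$.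 Consider the averaged VOC dynamics, for all $j\in\mathcal N$, $$\dot r_j=\frac{\alpha}{2C}\Big(r_j-\frac{\beta}{4}r_j^3\Big)-\frac{\kappa_j}{C r_j}P_j,\qquad \dot\theta_j=\frac{\kappa_j}{C r_j^2}Q_j,$$ $$P_j=\frac{r_j\iota_j}{2}\cos(\theta_j-\gamma_j)+\frac{r_j^2}{2}g_{jj}-\frac{r_j}{2}\sum_{\ell\ne j}g_{j\ell}r_\ell\cos(\theta_j-\theta_\ell),\qquad Q_j=\frac{r_j\iota_j}{2}\sin(\theta_j-\gamma_j)-\frac{r_j}{2}\sum_{\ell}g_{j\ell}r_\ell\sin(\theta_j-\theta_\ell).$$ Let $r^{\mathrm{oc}}=\sqrt{4\alpha/(3k)}$, and assume that for all $j\in\mathcal N$ we have $\kappa_jg_{jj}<\alpha$ and $$\frac{16}{81}(\alpha-\kappa_jg_{jj})^3\ \ge\ k\kappa_j^2\Big(\iota_j+r^{\mathrm{oc}}\sum_{\ell\neq j}g_{j\ell}\Big)^2 .$$ Put $r_j^{\mathrm{low}}=\sqrt{\tfrac{4}{9k}(\alpha-\kappa_jg_{jj})}>0$. Let $(r_0,\theta_0)$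 be an initial condition with $r_j^{\mathrm{low}}\le r_{0,j}\le r^{\mathrm{oc}}$ for all $j$, and suppose that the amplitudes of the solution starting there do not exceed $r^{\mathrm{oc}}$ for as long as the solution exists. Then the solution exists for all $t\ge 0$ and is unique, it satisfies $r_j(t)\ge r_j^{\mathrm{low}}>0$ for all $j$ and all $t\ge0$, and as $t\to\infty$ it converges to the set of equilibria $(r,\theta)$ with $r_j^{\mathrm{low}}\le r_j\le r^{\mathrm{oc}}$ for all $j$, which is nonempty. -/

import Mathlib

open Set Filter Topology

namespace VOC

/-- A connected resistive network.  The inverters sit at the nodes `N`; the nodes `I` are the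
internal ones.  `line j l` is the conductance of the line between `j` and `l` (zero when there is
no line), `shunt j` the shunt conductance at `j`, and `source m` the complex phasor, in the frame
rotating at the nominal frequency `ω`, of the current source at the internal node `m`: its current
is `t ↦ Re (source m * exp (i ω t))`. -/
structure Network (N I : Type*) where
  line : N ⊕ I → N ⊕ I → ℝ
  shunt : N ⊕ I → ℝ
  source : I → ℂ
  line_nonneg : ∀ j l, 0 ≤ line j l
  line_symm : ∀ j l, line j l = line l j
  line_self : ∀ j, line j j = 0
  shunt_nonneg : ∀ j, 0 ≤ shunt j
  connected : (SimpleGraph.fromRel fun j l => 0 < line j l).Connected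

/-- Parameters of the Van der Pol oscillators: damping `α`, cubic coefficient `k` of the nonlinear
current source, capacitance `C`, and the current gains `κ j`. -/
structure Params (N : Type*) where
  α : ℝ
  k : ℝ
  C : ℝ
  κ : N → ℝ
  α_pos : 0 < α
  k_pos : 0 < k
  C_pos : 0 < C
  κ_pos : ∀ j, 0 < κ j

noncomputable section

variable {N I : Type*} [Fintype N] [Fintype I] [DecidableEq N] [DecidableEq I]

namespace Network

variable (net : Network N I)

/-- The conductance matrix of the whole network. -/
def conductance : Matrix (N ⊕ I) (N ⊕ I) ℝ :=
  Matrix.of fun j l => if j = l then net.shunt j + ∑ m, net.line j m else -net.line j l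

/-- The Kron-reduced conductance matrix `Q_NN - Q_NI Q_II⁻¹ Q_NIᵀ`. -/
def kron : Matrix N N ℝ :=
  net.conductance.toBlocks₁₁ -
    net.conductance.toBlocks₁₂ * net.conductance.toBlocks₂₂⁻¹ * net.conductance.toBlocks₁₂.transpose

/-- The effective conductances of the Kron-reduced network: for `j ≠ l` the conductance `-Q_jl` of
the effective line, for `j = l` the diagonal entry `Q_jj`, i.e. the effective shunt conductance
plus the conductances of all effective lines at `j`. -/
def g (j l : N) : ℝ := if j = l then net.kron j j else -net.kron j l

/-- The phasor of the equivalent current source at inverter `j`: the entry `j` of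
`Q_NI Q_II⁻¹ i_I`. -/
def reducedSource (j : N) : ℂ :=
  ∑ m, (((net.conductance.toBlocks₁₂ * net.conductance.toBlocks₂₂⁻¹) j m : ℝ) : ℂ) * net.source m

/-- The amplitude of the equivalent current source `ι_j cos (ω t + γ_j)`. -/
def ι (j : N) : ℝ := ‖net.reducedSource j‖

/-- The phase offset of the equivalent current source `ι_j cos (ω t + γ_j)`. -/
def γ (j : N) : ℝ := (net.reducedSource j).arg

/-- Average active-power injection of inverter `j`. -/
def P (r θ : N → ℝ) (j : N) : ℝ :=
  r j * net.ι j / 2 * Real.cos (θ j - net.γ j) + r j ^ 2 / 2 * net.g j j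
    - r j / 2 * ∑ l ∈ Finset.univ.erase j, net.g j l * r l * Real.cos (θ j - θ l)

/-- Average reactive-power injection of inverter `j`. -/
def Q (r θ : N → ℝ) (j : N) : ℝ :=
  r j * net.ι j / 2 * Real.sin (θ j - net.γ j)
    - r j / 2 * ∑ l, net.g j l * r l * Real.sin (θ j - θ l)

end Network

/-- `β = 3 k / α`. -/
def Params.β (p : Params N) : ℝ := 3 * p.k / p.α

/-- The open-circuit voltage. -/
def Params.rOC (p : Params N) : ℝ := Real.sqrt (4 * p.α / (3 * p.k))

variable (net : Network N I) (p : Params N)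

/-- The lower amplitude bound of inverter `j`. -/
def rLow (j : N) : ℝ := Real.sqrt (4 / (9 * p.k) * (p.α - p.κ j * net.g j j))

/-- Right-hand side of the averaged amplitude dynamics. -/
def ampField (r θ : N → ℝ) (j : N) : ℝ :=
  p.α / (2 * p.C) * (r j - p.β / 4 * r j ^ 3) - p.κ j / (p.C * r j) * net.P r θ j

/-- Right-hand side of the averaged phase dynamics. -/
def phaseField (r θ : N → ℝ) (j : N) : ℝ :=
  p.κ j / (p.C * r j ^ 2) * net.Q r θ j

/-- `(r, θ)` solves the averaged VOC dynamics on the time interval `J`; the phases are lifted from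
the circle to the real line. -/
def IsSolution (J : Set ℝ) (r θ : ℝ → N → ℝ) : Prop :=
  ∀ t ∈ J, ∀ j,
    HasDerivWithinAt (fun s => r s j) (ampField net p (r t) (θ t) j) J t ∧
    HasDerivWithinAt (fun s => θ s j) (phaseField net p (r t) (θ t) j) J t

/-- The equilibria whose amplitudes lie between the lower bounds and the open-circuit voltage.  The
set is `2π`-periodic in each phase, so that the distance to it is the distance on the torus. -/
def equilibria : Set ((N → ℝ) × (N → ℝ)) :=
  {x | (∀ j, rLow net p j ≤ x.1 j ∧ x.1 j ≤ p.rOC) ∧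
    ∀ j, ampField net p x.1 x.2 j = 0 ∧ phaseField net p x.1 x.2 j = 0}

end

end VOC

/-!
In the complex amplitudes `z j = r j * exp (i θ j)` the averaged dynamics are polynomial, and, since
the Kron-reduced conductances are symmetric, they are a gradient flow with respect to a metric
weighted by the current gains.  In polar coordinates this reads (`VOC.hasDerivAt_potential`)
`d/dt V = -∑ j, (2 C / κ j) * ((r j)'² + (r j * (θ j)')²)` for an explicit potential `V`.

The amplitudes are trapped between `rLow` and `rOC`.  The upper bound is assumed.  Given the upper
bound, the effective conductances being nonnegative (`VOC.Network.g_nonneg`, from the entrywise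
nonnegativity of the inverse of a weakly diagonally dominant matrix with nonpositive off-diagonal
entries, `Matrix.inv_nonneg_of_rowSum_nonneg`), the current drawn from inverter `j`
by the sources and the other inverters is at most `ι j + rOC * ∑ l ≠ j, g j l`.  The condition on
the parameters says exactly that this is compensated at `r j = rLow j` by the linear and cubic
terms; below that level the deficit `rLow j - r j` grows at most exponentially
(`VOC.ampField_ge`), hence stays zero (`VOC.IsSolution.rLow_le`).

On this box of amplitudes the vector field is bounded and Lipschitz, so that it can be replaced by
a globally bounded and Lipschitz field, obtained by clamping the amplitudes to a slightly larger
box.  Its trajectories exist for all times and are unique, and those starting in the smaller box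
never leave it, so that they solve the original equations
(`VOC.mem_box_of_hasDerivAt_clampedField`).

For the convergence, `V` is bounded below on the box and decreases at a rate that controls the
squares of the velocities, which are Lipschitz in time; thus the velocities tend to zero
(`tendsto_zero_of_deriv_le_neg_sq`).  Modulo `2π` in the phases the trajectory lies in a compact
set, and by continuity of the field all its accumulation points are equilibria
(`VOC.exists_subseq_tendsto_infDist`).  They witness that equilibria exist, and the distance of the
trajectory to the set of equilibria tends to zero along a subsequence of every sequence of times.
-/

/-! ### Bounded Lipschitz functions -/

/-- A real function that is both bounded and Lipschitz.  Unlike the Lipschitz functions, these are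
closed under products. -/
def IsBoundedLipschitz {X : Type*} [PseudoMetricSpace X] (f : X → ℝ) : Prop :=
  (∃ M, ∀ x, |f x| ≤ M) ∧ ∃ K, ∀ x y, |f x - f y| ≤ K * dist x y

namespace IsBoundedLipschitz

variable {X : Type*} [PseudoMetricSpace X] {f g : X → ℝ}

theorem const (c : ℝ) : IsBoundedLipschitz fun _ : X => c :=
  ⟨⟨|c|, fun _ => le_rfl⟩, 0, fun x y => by simp⟩

theorem add (hf : IsBoundedLipschitz f) (hg : IsBoundedLipschitz g) :
    IsBoundedLipschitz fun x => f x + g x := by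
  obtain ⟨⟨M, hM⟩, K, hK⟩ := hf
  obtain ⟨⟨M', hM'⟩, K', hK'⟩ := hg
  refine ⟨⟨M + M', fun x => (abs_add_le _ _).trans (add_le_add (hM x) (hM' x))⟩, K + K',
    fun x y => ?_⟩
  calc |f x + g x - (f y + g y)| = |(f x - f y) + (g x - g y)| := by ring_nf
    _ ≤ |f x - f y| + |g x - g y| := abs_add_le _ _
    _ ≤ (K + K') * dist x y := by linarith [hK x y, hK' x y]

theorem mul (hf : IsBoundedLipschitz f) (hg : IsBoundedLipschitz g) :
    IsBoundedLipschitz fun x => f x * g x := by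
  obtain ⟨⟨M, hM⟩, K, hK⟩ := hf
  obtain ⟨⟨M', hM'⟩, K', hK'⟩ := hg
  refine ⟨⟨M * M', fun x => ?_⟩, M * K' + K * M', fun x y => ?_⟩
  · rw [abs_mul]
    exact mul_le_mul (hM x) (hM' x) (abs_nonneg _) ((abs_nonneg _).trans (hM x))
  · calc |f x * g x - f y * g y| = |f x * (g x - g y) + (f x - f y) * g y| := by ring_nf
      _ ≤ |f x| * |g x - g y| + |f x - f y| * |g y| := by
          rw [← abs_mul, ← abs_mul]; exact abs_add_le _ _
      _ ≤ M * (K' * dist x y) + K * dist x y * M' :=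
          add_le_add
            (mul_le_mul (hM x) (hK' x y) (abs_nonneg _) ((abs_nonneg _).trans (hM x)))
            (mul_le_mul (hK x y) (hM' y) (abs_nonneg _) ((abs_nonneg _).trans (hK x y)))
      _ = (M * K' + K * M') * dist x y := by ring

theorem const_mul (c : ℝ) (hf : IsBoundedLipschitz f) : IsBoundedLipschitz fun x => c * f x :=
  (const c).mul hf

theorem sub (hf : IsBoundedLipschitz f) (hg : IsBoundedLipschitz g) :
    IsBoundedLipschitz fun x => f x - g x := by
  simpa [sub_eq_add_neg] using hf.add (hg.const_mul (-1))

theorem pow (hf : IsBoundedLipschitz f) (n : ℕ) : IsBoundedLipschitz fun x => f x ^ n := by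
  induction n with
  | zero => simpa using const (X := X) 1
  | succ n ih => simpa [pow_succ] using ih.mul hf

theorem sum {J : Type*} (s : Finset J) {f : J → X → ℝ} (hf : ∀ j, IsBoundedLipschitz (f j)) :
    IsBoundedLipschitz fun x => ∑ j ∈ s, f j x := by
  classical
  induction s using Finset.induction_on with
  | empty => simpa using const (X := X) 0
  | insert a s ha ih => simpa [Finset.sum_insert ha] using (hf a).add ih

theorem inv (hf : IsBoundedLipschitz f) {c : ℝ} (hc : 0 < c) (hcf : ∀ x, c ≤ f x) :
    IsBoundedLipschitz fun x => (f x)⁻¹ := by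
  obtain ⟨-, K, hK⟩ := hf
  have hpos : ∀ x, 0 < f x := fun x => hc.trans_le (hcf x)
  have hinv : ∀ x, |(f x)⁻¹| ≤ c⁻¹ := fun x => by
    rw [abs_of_pos (inv_pos.2 (hpos x))]; exact inv_anti₀ hc (hcf x)
  refine ⟨⟨c⁻¹, hinv⟩, c⁻¹ * K * c⁻¹, fun x y => ?_⟩
  have hxy : (f x)⁻¹ - (f y)⁻¹ = (f x)⁻¹ * (f y - f x) * (f y)⁻¹ := by
    field_simp [(hpos x).ne', (hpos y).ne']
  have hK' : |f y - f x| ≤ K * dist x y := by rw [abs_sub_comm]; exact hK x y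
  have h0 : 0 ≤ c⁻¹ := (inv_pos.2 hc).le
  calc |(f x)⁻¹ - (f y)⁻¹| = |(f x)⁻¹| * |f y - f x| * |(f y)⁻¹| := by rw [hxy, abs_mul, abs_mul]
    _ ≤ c⁻¹ * (K * dist x y) * c⁻¹ :=
        mul_le_mul (mul_le_mul (hinv x) hK' (abs_nonneg _) h0) (hinv y) (abs_nonneg _)
          (mul_nonneg h0 ((abs_nonneg _).trans hK'))
    _ = c⁻¹ * K * c⁻¹ * dist x y := by ring

theorem cos {K : NNReal} (hf : LipschitzWith K f) :
    IsBoundedLipschitz fun x => Real.cos (f x) :=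
  ⟨⟨1, fun x => Real.abs_cos_le_one _⟩, K, fun x y => by
    simpa [Real.dist_eq] using (Real.lipschitzWith_cos.comp hf).dist_le_mul x y⟩

theorem sin {K : NNReal} (hf : LipschitzWith K f) :
    IsBoundedLipschitz fun x => Real.sin (f x) :=
  ⟨⟨1, fun x => Real.abs_sin_le_one _⟩, K, fun x y => by
    simpa [Real.dist_eq] using (Real.lipschitzWith_sin.comp hf).dist_le_mul x y⟩

theorem clamp {K : NNReal} (hf : LipschitzWith K f) (a b : ℝ) :
    IsBoundedLipschitz fun x => max a (min b (f x)) := by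
  refine ⟨⟨max |a| |b|, fun x => ?_⟩, K, fun x y => ?_⟩
  · rw [abs_le]
    refine ⟨?_, ?_⟩
    · have := neg_abs_le a
      exact (neg_le_neg (le_max_left _ _)).trans (this.trans (le_max_left _ _))
    · exact max_le_max (le_abs_self a) ((min_le_left _ _).trans (le_abs_self b))
  · simpa [Real.dist_eq] using ((hf.const_min b).const_max a).dist_le_mul x y

end IsBoundedLipschitz

/-- A map into a finite product whose coordinates are bounded and Lipschitz is itself bounded and
Lipschitz. -/
theorem exists_bound_lipschitzWith_pi {X J : Type*} [PseudoMetricSpace X] [Fintype J]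
    {F : X → J → ℝ} (hF : ∀ j, IsBoundedLipschitz fun x => F x j) :
    ∃ M K : NNReal, (∀ x, ‖F x‖ ≤ M) ∧ LipschitzWith K F := by
  choose M hM using fun j => (hF j).1
  choose K hK using fun j => (hF j).2
  refine ⟨∑ j, (M j).toNNReal, ∑ j, (K j).toNNReal, fun x => ?_, ?_⟩
  · refine (pi_norm_le_iff_of_nonneg (NNReal.coe_nonneg _)).2 fun j => ?_
    refine ((hM j x).trans (Real.le_coe_toNNReal _)).trans ?_
    exact_mod_cast Finset.single_le_sum (f := fun j => (M j).toNNReal)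
      (fun _ _ => zero_le) (Finset.mem_univ j)
  · refine LipschitzWith.of_dist_le_mul fun x y => ?_
    refine (dist_pi_le_iff (by positivity)).2 fun j => ?_
    rw [Real.dist_eq]
    refine (hK j x y).trans (mul_le_mul_of_nonneg_right ?_ dist_nonneg)
    refine (Real.le_coe_toNNReal _).trans ?_
    exact_mod_cast Finset.single_le_sum (f := fun j => (K j).toNNReal)
      (fun _ _ => zero_le) (Finset.mem_univ j)

theorem lipschitzWith_phase {J : Type*} [Fintype J] (j : J) :
    LipschitzWith 1 fun x : (J → ℝ) × (J → ℝ) => x.2 j := by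
  simpa [Function.comp_def] using (LipschitzWith.eval (α := fun _ : J => ℝ) j).comp
    (LipschitzWith.prod_snd (α := J → ℝ) (β := J → ℝ))

theorem isBoundedLipschitz_cos_sub {J : Type*} [Fintype J] (j : J) (f : (J → ℝ) × (J → ℝ) → ℝ)
    {K : NNReal} (hf : LipschitzWith K f) :
    IsBoundedLipschitz fun x : (J → ℝ) × (J → ℝ) => Real.cos (x.2 j - f x) :=
  IsBoundedLipschitz.cos ((lipschitzWith_phase j).sub hf)

theorem isBoundedLipschitz_sin_sub {J : Type*} [Fintype J] (j : J) (f : (J → ℝ) × (J → ℝ) → ℝ)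
    {K : NNReal} (hf : LipschitzWith K f) :
    IsBoundedLipschitz fun x : (J → ℝ) × (J → ℝ) => Real.sin (x.2 j - f x) :=
  IsBoundedLipschitz.sin ((lipschitzWith_phase j).sub hf)

/-! ### Ordinary differential equations -/

/-- A bounded, globally Lipschitz vector field has complete flow lines. -/
theorem exists_forall_hasDerivAt_of_bounded_lipschitz {E : Type*} [NormedAddCommGroup E]
    [NormedSpace ℝ E] [CompleteSpace E] {v : E → E} {M K : NNReal} (hM : ∀ x, ‖v x‖ ≤ M)
    (hK : LipschitzWith K v) (x₀ : E) :
    ∃ x : ℝ → E, x 0 = x₀ ∧ ∀ t, HasDerivAt x (v (x t)) t := by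
  -- A ball of radius `M * n` cannot be left before time `n`.
  have hloc : ∀ n : ℕ, ∃ x : ℝ → E, x 0 = x₀ ∧
      ∀ t ∈ Ioo (-(n : ℝ)) n, HasDerivAt x (v (x t)) t := by
    intro n
    have h0 : (0 : ℝ) ∈ Icc (-(n : ℝ)) n := by simp
    have hPL : IsPicardLindelof (fun _ => v) (⟨0, h0⟩ : Icc (-(n : ℝ)) n) x₀ (M * n) 0 M K :=
      IsPicardLindelof.of_time_independent (fun x _ => hM x) hK.lipschitzOnWith (by simp)
    obtain ⟨x, hx0, hx⟩ := hPL.exists_eq_forall_mem_Icc_hasDerivWithinAt₀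
    exact ⟨x, hx0, fun t ht => (hx t (Ioo_subset_Icc_self ht)).hasDerivAt (Icc_mem_nhds ht.1 ht.2)⟩
  choose X hX0 hX using hloc
  have heq : ∀ m n : ℕ, ∀ t : ℝ, |t| < m → |t| < n → X m t = X n t := by
    intro m n t hm hn
    have hpos : (0 : ℝ) < min (m : ℝ) n := (abs_nonneg t).trans_lt (lt_min hm hn)
    refine ODE_solution_unique_of_mem_Ioo (v := fun _ => v) (s := fun _ => univ) (K := K)
      (a := -(min (m : ℝ) n)) (b := min (m : ℝ) n) (t₀ := 0)
      (fun _ _ => hK.lipschitzOnWith) ⟨by linarith, hpos⟩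
      (fun s hs => ⟨hX m s ?_, mem_univ _⟩) (fun s hs => ⟨hX n s ?_, mem_univ _⟩)
      ((hX0 m).trans (hX0 n).symm) (abs_lt.1 (lt_min hm hn))
    · exact abs_lt.1 ((abs_lt.2 hs).trans_le (min_le_left _ _))
    · exact abs_lt.1 ((abs_lt.2 hs).trans_le (min_le_right _ _))
  have hlt : ∀ t : ℝ, |t| < ((⌈|t|⌉₊ + 1 : ℕ) : ℝ) := fun t => by
    push_cast
    linarith [Nat.le_ceil |t|]
  refine ⟨fun t => X (⌈|t|⌉₊ + 1) t, hX0 _, fun t => ?_⟩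
  refine (hX (⌈|t|⌉₊ + 1) t (abs_lt.1 (hlt t))).congr_of_eventuallyEq ?_
  filter_upwards [(isOpen_lt continuous_abs continuous_const).mem_nhds (hlt t)] with s hs
  exact heq _ _ s (hlt s) hs

/-- One-sided barrier: if `f` decreases below the level `c` at most at the rate `L * (c - f)`,
then it never falls below `c`. -/
theorem le_of_neg_mul_sub_le_deriv {f f' : ℝ → ℝ} {a b c L : ℝ}
    (hf : ContinuousOn f (Icc a b)) (hf' : ∀ t ∈ Ico a b, HasDerivWithinAt f (f' t) (Ici t) t)
    (ha : c ≤ f a) (hbd : ∀ t ∈ Ico a b, f t < c → -L * (c - f t) ≤ f' t) :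
    ∀ t ∈ Icc a b, c ≤ f t := by
  intro t ht
  have key : ∀ ε > 0, c - f t ≤ ε * Real.exp ((L + 1) * t) := by
    intro ε hε
    have hB : ∀ s, HasDerivAt (fun s => ε * Real.exp ((L + 1) * s))
        (ε * (Real.exp ((L + 1) * s) * (L + 1))) s := fun s => by
      simpa using (((hasDerivAt_id s).const_mul (L + 1)).exp).const_mul ε
    refine image_le_of_deriv_right_lt_deriv_boundary' (f := fun s => c - f s)
      (f' := fun s => -f' s) (a := a) (b := b) (continuousOn_const.sub hf)
      (fun s hs => (hf' s hs).const_sub c) ?_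
      (fun s _ => (hB s).continuousAt.continuousWithinAt)
      (fun s _ => (hB s).hasDerivWithinAt) ?_ ht
    · have := mul_pos hε (Real.exp_pos ((L + 1) * a))
      linarith
    · intro s hs heq
      have hpos := mul_pos hε (Real.exp_pos ((L + 1) * s))
      have h := hbd s hs (by linarith)
      rw [heq] at h
      linarith
  have hlim : Tendsto (fun ε : ℝ => ε * Real.exp ((L + 1) * t)) (𝓝[>] 0) (𝓝 0) := by
    have hc : Continuous fun ε : ℝ => ε * Real.exp ((L + 1) * t) := by fun_prop
    simpa using (hc.tendsto 0).mono_left nhdsWithin_le_nhds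
  have := ge_of_tendsto hlim (eventually_mem_nhdsWithin.mono fun ε hε => key ε hε)
  linarith

/-- A Barbalat-type lemma: if a function `V` that is bounded below on `[0, ∞)` decreases at least at
the rate `c * f ^ 2` for a Lipschitz function `f`, then `f` tends to zero. -/
theorem tendsto_zero_of_deriv_le_neg_sq {V V' f : ℝ → ℝ} {c m K : ℝ} (hc : 0 < c)
    (hV : ∀ t, 0 ≤ t → HasDerivAt V (V' t) t) (hV' : ∀ t, 0 ≤ t → V' t ≤ -c * f t ^ 2)
    (hm : ∀ t, 0 ≤ t → m ≤ V t)
    (hK : ∀ s t, 0 ≤ s → 0 ≤ t → |f s - f t| ≤ K * |s - t|) :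
    Tendsto f atTop (𝓝 0) := by
  have hdecr : ∀ s t d : ℝ, 0 ≤ s → s ≤ t → (∀ u ∈ Icc s t, V' u ≤ d) →
      V t - V s ≤ d * (t - s) := by
    intro s t d hs hst hd
    have hder : ∀ u ∈ Icc s t, HasDerivAt V (V' u) u := fun u hu => hV u (hs.trans hu.1)
    refine (convex_Icc s t).image_sub_le_mul_sub_of_deriv_le
      (fun u hu => (hder u hu).continuousAt.continuousWithinAt)
      (fun u hu => (hder u (interior_subset hu)).differentiableAt.differentiableWithinAt)
      (fun u hu => ?_) s (left_mem_Icc.2 hst) t (right_mem_Icc.2 hst) hst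
    rw [(hder u (interior_subset hu)).deriv]
    exact hd u (interior_subset hu)
  have hanti : ∀ s t : ℝ, 0 ≤ s → s ≤ t → V t ≤ V s := by
    intro s t hs hst
    have := hdecr s t 0 hs hst fun u hu =>
      (hV' u (hs.trans hu.1)).trans (by nlinarith [sq_nonneg (f u)])
    linarith
  rw [Metric.tendsto_atTop]
  intro ε hε
  -- Within time `δ` the function `f` changes by at most `ε / 2`.
  obtain ⟨δ, hδ, hKδ⟩ : ∃ δ > 0, |K| * δ ≤ ε / 2 :=
    ⟨ε / 2 / (|K| + 1), by positivity, by
      rw [mul_div_assoc', div_le_iff₀ (by positivity)]; nlinarith [abs_nonneg K]⟩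
  set η := c * (ε / 2) ^ 2 * δ with hη
  have hηpos : 0 < η := by positivity
  -- `V` comes within `η / 2` of its infimum; after that it cannot drop by `η`.
  have hbdd : BddBelow (V '' Ici 0) := ⟨m, by rintro _ ⟨t, ht, rfl⟩; exact hm t ht⟩
  have hne : (V '' Ici 0).Nonempty := ⟨V 0, mem_image_of_mem V self_mem_Ici⟩
  obtain ⟨_, ⟨T, hT, rfl⟩, hTlt⟩ :=
    exists_lt_of_csInf_lt hne (lt_add_of_pos_right (sInf (V '' Ici 0)) hηpos)
  refine ⟨T, fun t hTt => ?_⟩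
  have ht0 : (0 : ℝ) ≤ t := le_trans hT hTt
  rw [Real.dist_eq, sub_zero]
  by_contra! hge
  have hdrop : V (t + δ) - V t ≤ -c * (ε / 2) ^ 2 * (t + δ - t) := by
    refine hdecr t (t + δ) _ ht0 (by linarith) fun u hu => (hV' u (ht0.trans hu.1)).trans ?_
    have h1 : |f t - f u| ≤ ε / 2 := by
      refine (hK t u ht0 (ht0.trans hu.1)).trans (le_trans ?_ hKδ)
      refine mul_le_mul (le_abs_self K) ?_ (abs_nonneg _) (abs_nonneg _)
      rw [abs_le]; constructor <;> linarith [hu.1, hu.2]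
    have h2 : ε / 2 ≤ |f u| := by
      have := abs_sub_abs_le_abs_sub (f t) (f u)
      linarith
    have h3 : (ε / 2) ^ 2 ≤ f u ^ 2 := by
      rw [← sq_abs (f u)]; exact pow_le_pow_left₀ (by positivity) h2 2
    nlinarith
  have h1 := hanti T t hT hTt
  have h2 : sInf (V '' Ici 0) ≤ V (t + δ) :=
    csInf_le hbdd (mem_image_of_mem V (by simp only [mem_Ici]; linarith))
  rw [add_sub_cancel_left] at hdrop
  linarith

/-! ### Kron reduction -/

/-- Minimum principle: at a negative minimum of `x` the entry of `A *ᵥ x` would be nonpositive. -/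
theorem Matrix.nonneg_of_forall_mulVec_pos {I : Type*} [Fintype I] {A : Matrix I I ℝ}
    (hoff : ∀ i j, i ≠ j → A i j ≤ 0) (hrow : ∀ i, 0 ≤ ∑ j, A i j) {x : I → ℝ}
    (hx : ∀ i, 0 < A.mulVec x i) (i : I) : 0 ≤ x i := by
  have : Nonempty I := ⟨i⟩
  obtain ⟨m, hm⟩ := Finite.exists_min x
  by_contra! hneg
  have hm0 : x m < 0 := (hm i).trans_lt hneg
  have hle : A.mulVec x m ≤ 0 := by
    have hsplit : A.mulVec x m = ∑ j, A m j * (x j - x m) + (∑ j, A m j) * x m := by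
      rw [Matrix.mulVec, dotProduct, Finset.sum_mul, ← Finset.sum_add_distrib]
      exact Finset.sum_congr rfl fun j _ => by ring
    have h1 : ∑ j, A m j * (x j - x m) ≤ 0 := by
      refine Finset.sum_nonpos fun j _ => ?_
      rcases eq_or_ne m j with rfl | hj
      · simp
      · exact mul_nonpos_of_nonpos_of_nonneg (hoff m j hj) (sub_nonneg.2 (hm j))
    have h2 := mul_nonpos_of_nonneg_of_nonpos (hrow m) hm0.le
    linarith
  exact absurd (hx m) hle.not_gt

/-- The inverse of a weakly diagonally dominant matrix with nonpositive off-diagonal entries is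
entrywise nonnegative.  For a singular matrix `A⁻¹ = 0`, and the claim is trivial. -/
theorem Matrix.inv_nonneg_of_rowSum_nonneg {I : Type*} [Fintype I] [DecidableEq I]
    {A : Matrix I I ℝ} (hoff : ∀ i j, i ≠ j → A i j ≤ 0) (hrow : ∀ i, 0 ≤ ∑ j, A i j)
    (i j : I) : 0 ≤ A⁻¹ i j := by
  by_cases hA : IsUnit A.det
  swap
  · simp [Matrix.nonsing_inv_apply_not_isUnit A hA]
  -- Perturbing the column `A⁻¹ *ᵥ e_j` by `ε • A⁻¹ *ᵥ 1` makes the right-hand side positive.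
  have key : ∀ ε > 0, 0 ≤ A⁻¹ i j + ε * ∑ l, A⁻¹ i l := by
    intro ε hε
    have h := Matrix.nonneg_of_forall_mulVec_pos hoff hrow
      (x := A⁻¹.mulVec (Pi.single j 1 + fun _ => ε)) (fun m => by
        rw [Matrix.mulVec_mulVec, Matrix.mul_nonsing_inv A hA, Matrix.one_mulVec]
        have : (0 : ℝ) ≤ (Pi.single j 1 : I → ℝ) m := by
          rw [Pi.single_apply]; split_ifs <;> norm_num
        simp only [Pi.add_apply]
        linarith) i
    rw [Matrix.mulVec_add] at h
    simpa [Matrix.mulVec, dotProduct, Finset.mul_sum, mul_comm] using h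
  have hlim : Tendsto (fun ε : ℝ => A⁻¹ i j + ε * ∑ l, A⁻¹ i l) (𝓝[>] 0) (𝓝 (A⁻¹ i j)) := by
    have hc : Continuous fun ε : ℝ => A⁻¹ i j + ε * ∑ l, A⁻¹ i l := by fun_prop
    simpa using (hc.tendsto 0).mono_left nhdsWithin_le_nhds
  exact ge_of_tendsto hlim (eventually_mem_nhdsWithin.mono fun ε hε => key ε hε)

namespace VOC

variable {N I : Type*} [Fintype N] [Fintype I] [DecidableEq N] [DecidableEq I]

namespace Network

theorem conductance_symm (net : Network N I) (j l : N ⊕ I) :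
    net.conductance j l = net.conductance l j := by
  simp only [conductance, Matrix.of_apply]
  by_cases h : j = l
  · subst h; rfl
  · rw [if_neg h, if_neg (Ne.symm h), net.line_symm]

theorem conductance_nonpos (net : Network N I) {j l : N ⊕ I} (h : j ≠ l) :
    net.conductance j l ≤ 0 := by
  simp only [conductance, Matrix.of_apply, if_neg h]
  exact neg_nonpos.2 (net.line_nonneg j l)

theorem conductance_rowSum (net : Network N I) (j : N ⊕ I) :
    ∑ l, net.conductance j l = net.shunt j := by
  have h : ∀ l, net.conductance j l =
      (if j = l then net.shunt j + ∑ m, net.line j m else 0) - net.line j l := by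
    intro l
    simp only [conductance, Matrix.of_apply]
    split_ifs with hl
    · subst hl; rw [net.line_self]; ring
    · ring
  simp [h, Finset.sum_sub_distrib]

theorem inv_internal_nonneg (net : Network N I) (m n : I) :
    0 ≤ net.conductance.toBlocks₂₂⁻¹ m n := by
  refine Matrix.inv_nonneg_of_rowSum_nonneg
    (fun i j hij => net.conductance_nonpos (by simpa using hij)) (fun i => ?_) m n
  have h := net.conductance_rowSum (Sum.inr i)
  rw [Fintype.sum_sum_type] at h
  have h1 : ∑ a : N, net.conductance (Sum.inr i) (Sum.inl a) ≤ 0 :=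
    Finset.sum_nonpos fun a _ => net.conductance_nonpos (by simp)
  have h2 := net.shunt_nonneg (Sum.inr i)
  change 0 ≤ ∑ b, net.conductance (Sum.inr i) (Sum.inr b)
  linarith

theorem kron_symm (net : Network N I) (j l : N) : net.kron j l = net.kron l j := by
  have h : net.kron.transpose = net.kron := by
    have h11 : net.conductance.toBlocks₁₁.transpose = net.conductance.toBlocks₁₁ := by
      ext a b; exact net.conductance_symm _ _
    have h22 : net.conductance.toBlocks₂₂.transpose = net.conductance.toBlocks₂₂ := by
      ext a b; exact net.conductance_symm _ _
    rw [kron, Matrix.transpose_sub, Matrix.transpose_mul, Matrix.transpose_mul,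
      Matrix.transpose_transpose, Matrix.transpose_nonsing_inv, h11, h22, Matrix.mul_assoc]
  exact congrFun (congrFun h l) j

theorem g_symm (net : Network N I) (j l : N) : net.g j l = net.g l j := by
  by_cases h : j = l
  · rw [h]
  · simp only [g, if_neg h, if_neg (Ne.symm h), net.kron_symm j l]

/-- The effective lines of the Kron-reduced network have nonnegative conductances. -/
theorem g_nonneg (net : Network N I) {j l : N} (h : j ≠ l) : 0 ≤ net.g j l := by
  rw [g, if_neg h, kron, Matrix.sub_apply, neg_sub, sub_nonneg]
  refine le_trans (net.conductance_nonpos (j := Sum.inl j) (l := Sum.inl l) (by simpa using h)) ?_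
  have hB : ∀ a b, net.conductance.toBlocks₁₂ a b ≤ 0 := fun a b =>
    net.conductance_nonpos (j := Sum.inl a) (l := Sum.inr b) (by simp)
  simp only [Matrix.mul_apply, Matrix.transpose_apply]
  refine Finset.sum_nonneg fun n _ => mul_nonneg_of_nonpos_of_nonpos ?_ (hB l n)
  exact Finset.sum_nonpos fun m _ =>
    mul_nonpos_of_nonpos_of_nonneg (hB j m) (net.inv_internal_nonneg m n)

end Network

/-! ### The vector field -/

/-- Away from `r j = 0` the amplitude dynamics are polynomial in the amplitudes. -/
theorem ampField_eq (net : Network N I) (p : Params N) {r : N → ℝ} (θ : N → ℝ) {j : N}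
    (h : r j ≠ 0) :
    ampField net p r θ j = 1 / (2 * p.C) * ((p.α - p.κ j * net.g j j) * r j
      - 3 * p.k / 4 * r j ^ 3 - p.κ j * net.ι j * Real.cos (θ j - net.γ j)
      + p.κ j * ∑ l ∈ Finset.univ.erase j, net.g j l * r l * Real.cos (θ j - θ l)) := by
  have hα := p.α_pos.ne'
  have hC := p.C_pos.ne'
  rw [ampField, Network.P, Params.β]
  field_simp
  ring

theorem phaseField_eq (net : Network N I) (p : Params N) {r : N → ℝ} (θ : N → ℝ) {j : N}
    (h : r j ≠ 0) :
    r j * phaseField net p r θ j = p.κ j / (2 * p.C) * (net.ι j * Real.sin (θ j - net.γ j)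
      - ∑ l ∈ Finset.univ.erase j, net.g j l * r l * Real.sin (θ j - θ l)) := by
  have hC := p.C_pos.ne'
  have hsum : ∑ l, net.g j l * r l * Real.sin (θ j - θ l)
      = ∑ l ∈ Finset.univ.erase j, net.g j l * r l * Real.sin (θ j - θ l) :=
    (Finset.sum_erase _ (by simp)).symm
  rw [phaseField, Network.Q, hsum]
  field_simp

theorem cos_sub_sub_int_mul_two_pi (a b : ℝ) (m n : ℤ) :
    Real.cos (a - m * (2 * Real.pi) - (b - n * (2 * Real.pi))) = Real.cos (a - b) := by
  rw [← Real.cos_sub_int_mul_two_pi (a - b) (m - n)]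
  push_cast
  ring_nf

theorem sin_sub_sub_int_mul_two_pi (a b : ℝ) (m n : ℤ) :
    Real.sin (a - m * (2 * Real.pi) - (b - n * (2 * Real.pi))) = Real.sin (a - b) := by
  rw [← Real.sin_sub_int_mul_two_pi (a - b) (m - n)]
  push_cast
  ring_nf

theorem ampField_periodic (net : Network N I) (p : Params N) (r θ : N → ℝ) (n : N → ℤ) :
    ampField net p r (fun j => θ j - n j * (2 * Real.pi)) = ampField net p r θ := by
  ext j
  have h := cos_sub_sub_int_mul_two_pi (θ j) (net.γ j) (n j) 0
  simp only [Int.cast_zero, zero_mul, sub_zero] at h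
  simp only [ampField, Network.P, cos_sub_sub_int_mul_two_pi, h]

theorem phaseField_periodic (net : Network N I) (p : Params N) (r θ : N → ℝ) (n : N → ℤ) :
    phaseField net p r (fun j => θ j - n j * (2 * Real.pi)) = phaseField net p r θ := by
  ext j
  have h := sin_sub_sub_int_mul_two_pi (θ j) (net.γ j) (n j) 0
  simp only [Int.cast_zero, zero_mul, sub_zero] at h
  simp only [phaseField, Network.Q, sin_sub_sub_int_mul_two_pi, h]

/-! ### The lower amplitude bound -/

theorem rLow_pos (net : Network N I) (p : Params N) (j : N) (hpos : p.κ j * net.g j j < p.α) :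
    0 < rLow net p j := by
  have := p.k_pos
  have := sub_pos.2 hpos
  exact Real.sqrt_pos.2 (by positivity)

/-- The condition on the parameters says that at the amplitude `rLow` the net linear and cubic terms
dominate the worst-case current drawn by the sources and the neighbouring inverters. -/
theorem current_le_of_key (net : Network N I) (p : Params N) (j : N)
    (hpos : p.κ j * net.g j j < p.α)
    (hkey : p.k * p.κ j ^ 2 *
        (net.ι j + p.rOC * ∑ l ∈ Finset.univ.erase j, net.g j l) ^ 2
      ≤ 16 / 81 * (p.α - p.κ j * net.g j j) ^ 3) :
    p.κ j * (net.ι j + p.rOC * ∑ l ∈ Finset.univ.erase j, net.g j l)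
      ≤ 2 / 3 * (p.α - p.κ j * net.g j j) * rLow net p j := by
  set a := p.α - p.κ j * net.g j j with ha
  have ha0 : 0 < a := sub_pos.2 hpos
  have hk := p.k_pos
  have hL0 := rLow_pos net p j hpos
  have hL2 : rLow net p j ^ 2 = 4 / (9 * p.k) * a := Real.sq_sqrt (by positivity)
  refine (le_abs_self _).trans (abs_le_of_sq_le_sq ?_ (by positivity))
  rw [mul_pow, mul_pow _ (rLow net p j), hL2, ← mul_le_mul_iff_right₀ hk]
  calc p.k * (p.κ j ^ 2 * (net.ι j + p.rOC * ∑ l ∈ Finset.univ.erase j, net.g j l) ^ 2)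
      ≤ 16 / 81 * a ^ 3 := by rw [← mul_assoc]; exact hkey
    _ = p.k * ((2 / 3 * a) ^ 2 * (4 / (9 * p.k) * a)) := by field_simp; ring

/-- Below `rLow`, the amplitude decreases at most at a rate proportional to the deficit. -/
theorem ampField_ge (net : Network N I) (p : Params N) {j : N}
    (hpos : p.κ j * net.g j j < p.α)
    (hkey : p.k * p.κ j ^ 2 *
        (net.ι j + p.rOC * ∑ l ∈ Finset.univ.erase j, net.g j l) ^ 2
      ≤ 16 / 81 * (p.α - p.κ j * net.g j j) ^ 3)
    {r : N → ℝ} (θ : N → ℝ) (hr : ∀ l, 0 < r l ∧ r l ≤ p.rOC) (hj : r j ≤ rLow net p j) :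
    -((p.α - p.κ j * net.g j j) / (2 * p.C)) * (rLow net p j - r j) ≤ ampField net p r θ j := by
  have hcur := current_le_of_key net p j hpos hkey
  rw [ampField_eq net p θ (hr j).1.ne']
  set a := p.α - p.κ j * net.g j j with ha
  set L := rLow net p j with hL
  have ha0 : 0 < a := sub_pos.2 hpos
  have hk := p.k_pos
  have hC := p.C_pos
  have hκ := p.κ_pos j
  have hL0 : 0 < L := rLow_pos net p j hpos
  have hL2 : 9 * p.k * L ^ 2 = 4 * a := by
    rw [hL, rLow, Real.sq_sqrt (by positivity)]; field_simp; exact ha.symm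
  have hrj := (hr j).1
  have hι : net.ι j * Real.cos (θ j - net.γ j) ≤ net.ι j :=
    mul_le_of_le_one_right (norm_nonneg _) (Real.cos_le_one _)
  have hS : -(p.rOC * ∑ l ∈ Finset.univ.erase j, net.g j l)
      ≤ ∑ l ∈ Finset.univ.erase j, net.g j l * r l * Real.cos (θ j - θ l) := by
    rw [Finset.mul_sum, ← Finset.sum_neg_distrib]
    refine Finset.sum_le_sum fun l hl => ?_
    have hg := net.g_nonneg (Finset.ne_of_mem_erase hl).symm
    have h1 := mul_le_mul_of_nonneg_left (Real.neg_one_le_cos (θ j - θ l))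
      (mul_nonneg hg (hr l).1.le)
    have h2 := mul_le_mul_of_nonneg_left (hr l).2 hg
    linarith
  set S := ∑ l ∈ Finset.univ.erase j, net.g j l * r l * Real.cos (θ j - θ l)
  -- The cubic `a * r - 3 * k / 4 * r ^ 3` equals `2 / 3 * a * L` at `r = L`.
  have hcubic : 2 / 3 * a * L - a * (L - r j) ≤ a * r j - 3 * p.k / 4 * r j ^ 3 := by
    have h3 : r j ^ 3 ≤ L ^ 3 := pow_le_pow_left₀ hrj.le hj 3
    have h4 : 9 * p.k * L ^ 3 = 4 * a * L := by rw [pow_succ, ← mul_assoc, hL2]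
    have h5 := mul_le_mul_of_nonneg_left h3 (by positivity : 0 ≤ 3 * p.k / 4)
    linarith
  have hκι := mul_le_mul_of_nonneg_left hι hκ.le
  have hκS := mul_le_mul_of_nonneg_left hS hκ.le
  have hmain : -(a * (L - r j)) ≤ a * r j - 3 * p.k / 4 * r j ^ 3
      - p.κ j * net.ι j * Real.cos (θ j - net.γ j) + p.κ j * S := by
    linarith
  have hfin := mul_le_mul_of_nonneg_left hmain (by positivity : 0 ≤ 1 / (2 * p.C))
  calc -(a / (2 * p.C)) * (L - r j) = 1 / (2 * p.C) * -(a * (L - r j)) := by ring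
    _ ≤ _ := hfin

theorem IsSolution.continuousOn {net : Network N I} {p : Params N} {J : Set ℝ}
    {r θ : ℝ → N → ℝ} (h : IsSolution net p J r θ) (j : N) : ContinuousOn (fun t => r t j) J :=
  fun t ht => (h t ht j).1.continuousWithinAt

/-- As long as no amplitude exceeds the open-circuit voltage, no amplitude falls below `rLow`. -/
theorem IsSolution.rLow_le {net : Network N I} {p : Params N}
    (hpos : ∀ j, p.κ j * net.g j j < p.α)
    (hkey : ∀ j, p.k * p.κ j ^ 2 *
        (net.ι j + p.rOC * ∑ l ∈ Finset.univ.erase j, net.g j l) ^ 2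
      ≤ 16 / 81 * (p.α - p.κ j * net.g j j) ^ 3)
    {T : ℝ} {r θ : ℝ → N → ℝ} (h : IsSolution net p (Ico 0 T) r θ)
    (hr₀ : ∀ j, rLow net p j ≤ r 0 j) (hup : ∀ t ∈ Ico 0 T, ∀ j, r t j ≤ p.rOC) :
    ∀ t ∈ Ico 0 T, ∀ j, rLow net p j ≤ r t j := by
  intro t₁ ht₁
  have hsub : Icc 0 t₁ ⊆ Ico 0 T := fun s hs => ⟨hs.1, hs.2.trans_lt ht₁.2⟩
  suffices hS : Icc 0 t₁ ⊆ {t | ∀ j, rLow net p j ≤ r t j} from hS (right_mem_Icc.2 ht₁.1)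
  have hcl : IsClosed ({t | ∀ j, rLow net p j ≤ r t j} ∩ Icc 0 t₁) := by
    have : {t | ∀ j, rLow net p j ≤ r t j} ∩ Icc 0 t₁
        = Icc 0 t₁ ∩ (fun t => r t) ⁻¹' Ici (rLow net p) := by
      ext t; exact and_comm
    rw [this]
    exact ContinuousOn.preimage_isClosed_of_isClosed
      (continuousOn_pi.2 fun j => (h.continuousOn j).mono hsub) isClosed_Icc isClosed_Ici
  refine hcl.Icc_subset_of_forall_mem_nhdsWithin hr₀ fun t ht => ?_
  have ht0 : 0 ≤ t := ht.2.1
  have hnhds : ∀ s ∈ Ico 0 T, Ico 0 T ∈ 𝓝[≥] s := fun s hs =>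
    mem_of_superset (Ico_mem_nhdsGE hs.2) (Ico_subset_Ico_left hs.1)
  have htT : t ∈ Ico 0 T := ⟨ht0, ht.2.2.trans ht₁.2⟩
  -- The amplitudes remain positive for a short time, so that the barrier estimate applies.
  have hev : ∀ᶠ s in 𝓝[≥] t, s ∈ Ico 0 T ∧ ∀ j, 0 < r s j := by
    refine (eventually_of_mem (hnhds t htT) fun s hs => hs).and (eventually_all.2 fun j => ?_)
    have hc : ContinuousWithinAt (fun s => r s j) (Ici t) t :=
      (h.continuousOn j t htT).mono_of_mem_nhdsWithin (hnhds t htT)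
    exact hc.eventually_const_lt ((rLow_pos net p j (hpos j)).trans_le (ht.1 j))
  obtain ⟨u, hu, hut⟩ := (mem_nhdsGE_iff_exists_Icc_subset).1 hev
  refine mem_of_superset (Icc_mem_nhdsGT_of_mem ⟨le_rfl, hu⟩) fun s hs j => ?_
  refine le_of_neg_mul_sub_le_deriv (f := fun s => r s j)
    (f' := fun s => ampField net p (r s) (θ s) j) (a := t) (b := u)
    (L := (p.α - p.κ j * net.g j j) / (2 * p.C))
    ((h.continuousOn j).mono fun s hs => (hut hs).1) (fun s hs => ?_) (ht.1 j)
    (fun s hs hlt => ?_) s hs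
  · have hsI := (hut (Ico_subset_Icc_self hs)).1
    exact (h s hsI j).1.mono_of_mem_nhdsWithin (hnhds s hsI)
  · have hsI := hut (Ico_subset_Icc_self hs)
    exact ampField_ge net p (hpos j) (hkey j) (θ s) (fun l => ⟨hsI.2 l, hup s hsI.1 l⟩) hlt.le

/-! ### The truncated dynamics -/

/-- The amplitudes, clamped to the intervals `[rLow / 2, rOC + 1]`, which are neighbourhoods of the
intervals `[rLow, rOC]` of interest. -/
noncomputable def clampAmp (net : Network N I) (p : Params N) (r : N → ℝ) (j : N) : ℝ :=
  max (rLow net p j / 2) (min (p.rOC + 1) (r j))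

theorem clampAmp_eq (net : Network N I) (p : Params N) {r : N → ℝ}
    (h : ∀ j, rLow net p j / 2 ≤ r j ∧ r j ≤ p.rOC + 1) : clampAmp net p r = r := by
  ext j
  rw [clampAmp, min_eq_right (h j).2, max_eq_right (h j).1]

/-- The averaged VOC vector field, evaluated at the clamped amplitudes. -/
noncomputable def clampedField (net : Network N I) (p : Params N) (x : (N → ℝ) × (N → ℝ)) :
    (N → ℝ) × (N → ℝ) :=
  (ampField net p (clampAmp net p x.1) x.2, phaseField net p (clampAmp net p x.1) x.2)

theorem isBoundedLipschitz_clampAmp (net : Network N I) (p : Params N) (j : N) :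
    IsBoundedLipschitz fun x : (N → ℝ) × (N → ℝ) => clampAmp net p x.1 j :=
  IsBoundedLipschitz.clamp ((LipschitzWith.eval j).comp LipschitzWith.prod_fst) _ _

theorem isBoundedLipschitz_inv_clampAmp (net : Network N I) (p : Params N)
    (j : N) (hpos : p.κ j * net.g j j < p.α) :
    IsBoundedLipschitz fun x : (N → ℝ) × (N → ℝ) => (clampAmp net p x.1 j)⁻¹ :=
  (isBoundedLipschitz_clampAmp net p j).inv (half_pos (rLow_pos net p j hpos))
    fun _ => le_max_left _ _

theorem isBoundedLipschitz_clampedField_fst (net : Network N I) (p : Params N) (j : N)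
    (hpos : p.κ j * net.g j j < p.α) :
    IsBoundedLipschitz fun x => (clampedField net p x).1 j := by
  have hρ := isBoundedLipschitz_clampAmp net p
  have hP : IsBoundedLipschitz fun x : (N → ℝ) × (N → ℝ) =>
      net.P (clampAmp net p x.1) x.2 j := by
    have h1 := ((hρ j).const_mul (net.ι j / 2)).mul
      (isBoundedLipschitz_cos_sub j _ (LipschitzWith.const (net.γ j)))
    have h2 := ((hρ j).pow 2).const_mul (net.g j j / 2)
    have h3 := ((hρ j).const_mul (1 / 2)).mul (IsBoundedLipschitz.sum (Finset.univ.erase j)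
      fun l => ((hρ l).const_mul (net.g j l)).mul
        (isBoundedLipschitz_cos_sub j _ (lipschitzWith_phase l)))
    convert (h1.add h2).sub h3 using 2 with x
    rw [Network.P]; ring
  have h1 := ((hρ j).sub (((hρ j).pow 3).const_mul (p.β / 4))).const_mul (p.α / (2 * p.C))
  have h2 := ((isBoundedLipschitz_inv_clampAmp net p j hpos).const_mul (p.κ j / p.C)).mul hP
  convert h1.sub h2 using 2 with x
  simp only [clampedField]
  rw [ampField, ← div_div (p.κ j), div_eq_mul_inv (p.κ j / p.C)]

theorem isBoundedLipschitz_clampedField_snd (net : Network N I) (p : Params N) (j : N)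
    (hpos : p.κ j * net.g j j < p.α) :
    IsBoundedLipschitz fun x => (clampedField net p x).2 j := by
  have hρ := isBoundedLipschitz_clampAmp net p
  have hQ : IsBoundedLipschitz fun x : (N → ℝ) × (N → ℝ) =>
      net.Q (clampAmp net p x.1) x.2 j := by
    have h1 := ((hρ j).const_mul (net.ι j / 2)).mul
      (isBoundedLipschitz_sin_sub j _ (LipschitzWith.const (net.γ j)))
    have h3 := ((hρ j).const_mul (1 / 2)).mul (IsBoundedLipschitz.sum Finset.univ
      fun l => ((hρ l).const_mul (net.g j l)).mul
        (isBoundedLipschitz_sin_sub j _ (lipschitzWith_phase l)))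
    convert h1.sub h3 using 2 with x
    rw [Network.Q]; ring
  convert (((isBoundedLipschitz_inv_clampAmp net p j hpos).pow 2).const_mul (p.κ j / p.C)).mul hQ
    using 2 with x
  simp only [clampedField]
  rw [phaseField, ← div_div, div_eq_mul_inv (p.κ j / p.C), inv_pow]

theorem exists_bound_lipschitzWith_clampedField (net : Network N I) (p : Params N)
    (hpos : ∀ j, p.κ j * net.g j j < p.α) :
    ∃ M K : NNReal, (∀ x, ‖clampedField net p x‖ ≤ M) ∧ LipschitzWith K (clampedField net p) := by
  obtain ⟨M₁, K₁, hM₁, hK₁⟩ := exists_bound_lipschitzWith_pi fun j =>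
    isBoundedLipschitz_clampedField_fst net p j (hpos j)
  obtain ⟨M₂, K₂, hM₂, hK₂⟩ := exists_bound_lipschitzWith_pi fun j =>
    isBoundedLipschitz_clampedField_snd net p j (hpos j)
  refine ⟨max M₁ M₂, max K₁ K₂, fun x => ?_, hK₁.prodMk hK₂⟩
  rw [Prod.norm_def]
  exact max_le_max (hM₁ x) (hM₂ x)

/-- Along a trajectory whose amplitudes avoid the clamping, the two vector fields agree. -/
theorem IsSolution.hasDerivWithinAt {net : Network N I} {p : Params N} {J : Set ℝ}
    {r θ : ℝ → N → ℝ} (h : IsSolution net p J r θ) {t : ℝ} (ht : t ∈ J)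
    (hbox : ∀ j, rLow net p j / 2 ≤ r t j ∧ r t j ≤ p.rOC + 1) :
    HasDerivWithinAt (fun s => (r s, θ s)) (clampedField net p (r t, θ t)) J t := by
  have hc : clampedField net p (r t, θ t)
      = (ampField net p (r t) (θ t), phaseField net p (r t) (θ t)) := by
    rw [clampedField, clampAmp_eq net p hbox]
  rw [hc]
  exact (hasDerivWithinAt_pi.2 fun j => (h t ht j).1).prodMk
    (hasDerivWithinAt_pi.2 fun j => (h t ht j).2)

theorem isSolution_of_hasDerivAt {net : Network N I} {p : Params N} {J : Set ℝ}
    {x : ℝ → (N → ℝ) × (N → ℝ)} (h : ∀ t, HasDerivAt x (clampedField net p (x t)) t)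
    (hbox : ∀ t ∈ J, ∀ j, rLow net p j / 2 ≤ (x t).1 j ∧ (x t).1 j ≤ p.rOC + 1) :
    IsSolution net p J (fun t => (x t).1) fun t => (x t).2 := by
  intro t ht j
  have h1 := h t
  rw [clampedField, clampAmp_eq net p (hbox t ht)] at h1
  exact ⟨(hasDerivAt_pi.1 h1.fst j).hasDerivWithinAt, (hasDerivAt_pi.1 h1.snd j).hasDerivWithinAt⟩

/-! ### The potential -/

/-- The potential of which the averaged dynamics are a (weighted) gradient flow. -/
noncomputable def potential (net : Network N I) (p : Params N) (r θ : N → ℝ) : ℝ :=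
  ∑ j, (3 * p.k / (16 * p.κ j) * r j ^ 4 - (p.α - p.κ j * net.g j j) / (2 * p.κ j) * r j ^ 2
      + net.ι j * r j * Real.cos (θ j - net.γ j))
    - 1 / 2 * ∑ j, ∑ l ∈ Finset.univ.erase j, net.g j l * r j * r l * Real.cos (θ j - θ l)

theorem sum_sum_erase_comm (f : N → N → ℝ) :
    ∑ j, ∑ l ∈ Finset.univ.erase j, f l j = ∑ j, ∑ l ∈ Finset.univ.erase j, f j l :=
  Finset.sum_comm' fun j l => by simp [eq_comm]

theorem hasDerivAt_potential (net : Network N I) (p : Params N) {r θ : ℝ → N → ℝ} {t : ℝ}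
    (hr : ∀ j, 0 < r t j)
    (hr' : ∀ j, HasDerivAt (fun s => r s j) (ampField net p (r t) (θ t) j) t)
    (hθ' : ∀ j, HasDerivAt (fun s => θ s j) (phaseField net p (r t) (θ t) j) t) :
    HasDerivAt (fun s => potential net p (r s) (θ s))
      (-∑ j, 2 * p.C / p.κ j * (ampField net p (r t) (θ t) j ^ 2
        + (r t j * phaseField net p (r t) (θ t) j) ^ 2)) t := by
  set A := ampField net p (r t) (θ t) with hA
  set B := phaseField net p (r t) (θ t) with hB
  have h1 : ∀ j, HasDerivAt (fun s => 3 * p.k / (16 * p.κ j) * r s j ^ 4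
      - (p.α - p.κ j * net.g j j) / (2 * p.κ j) * r s j ^ 2
      + net.ι j * r s j * Real.cos (θ s j - net.γ j))
      (3 * p.k / (16 * p.κ j) * (4 * r t j ^ 3 * A j)
      - (p.α - p.κ j * net.g j j) / (2 * p.κ j) * (2 * r t j * A j)
      + (net.ι j * A j * Real.cos (θ t j - net.γ j)
        + net.ι j * r t j * (-Real.sin (θ t j - net.γ j) * B j))) t := by
    intro j
    have e4 := ((hr' j).fun_pow 4).const_mul (3 * p.k / (16 * p.κ j))
    have e2 := ((hr' j).fun_pow 2).const_mul ((p.α - p.κ j * net.g j j) / (2 * p.κ j))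
    have e0 := ((hr' j).const_mul (net.ι j)).fun_mul ((hθ' j).sub_const (net.γ j)).cos
    refine ((e4.fun_sub e2).fun_add e0).congr_deriv ?_
    norm_num
  have h2 : ∀ j l, HasDerivAt (fun s => net.g j l * r s j * r s l * Real.cos (θ s j - θ s l))
      ((net.g j l * A j * r t l + net.g j l * r t j * A l) * Real.cos (θ t j - θ t l)
        + net.g j l * r t j * r t l * (-Real.sin (θ t j - θ t l) * (B j - B l))) t := fun j l =>
    (((hr' j).const_mul (net.g j l)).fun_mul (hr' l)).fun_mul ((hθ' j).fun_sub (hθ' l)).cos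
  have hV := (HasDerivAt.fun_sum fun j (_ : j ∈ Finset.univ) => h1 j).fun_sub
    ((HasDerivAt.fun_sum fun j (_ : j ∈ Finset.univ) =>
      HasDerivAt.fun_sum fun l (_ : l ∈ Finset.univ.erase j) => h2 j l).const_mul (1 / 2))
  refine hV.congr_deriv ?_
  -- The two halves of the derivative of the line term of `j` and `l` are exchanged by `j ↔ l`.
  set D : N → N → ℝ := fun j l => net.g j l * r t l * Real.cos (θ t j - θ t l) * A j
    - net.g j l * r t l * Real.sin (θ t j - θ t l) * (r t j * B j) with hD
  have hsymm : ∑ j, ∑ l ∈ Finset.univ.erase j,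
      ((net.g j l * A j * r t l + net.g j l * r t j * A l) * Real.cos (θ t j - θ t l)
        + net.g j l * r t j * r t l * (-Real.sin (θ t j - θ t l) * (B j - B l)))
      = 2 * ∑ j, ∑ l ∈ Finset.univ.erase j, D j l := by
    have hterm : ∀ j l,
        ((net.g j l * A j * r t l + net.g j l * r t j * A l) * Real.cos (θ t j - θ t l)
        + net.g j l * r t j * r t l * (-Real.sin (θ t j - θ t l) * (B j - B l)))
        = D j l + D l j := by
      intro j l
      have hcos : Real.cos (θ t l - θ t j) = Real.cos (θ t j - θ t l) := by
        rw [← Real.cos_neg, neg_sub]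
      have hsin : Real.sin (θ t l - θ t j) = -Real.sin (θ t j - θ t l) := by
        rw [← Real.sin_neg, neg_sub]
      simp only [hD, hcos, hsin, net.g_symm l j]
      ring
    simp only [hterm, Finset.sum_add_distrib]
    rw [sum_sum_erase_comm D]
    ring
  rw [hsymm, ← mul_assoc, show (1 : ℝ) / 2 * 2 = 1 by norm_num, one_mul,
    ← Finset.sum_sub_distrib, ← Finset.sum_neg_distrib]
  refine Finset.sum_congr rfl fun j _ => ?_
  have hκ := (p.κ_pos j).ne'
  have hC := p.C_pos.ne'
  have hAj : 2 * p.C / p.κ j * A j = (p.α - p.κ j * net.g j j) / p.κ j * r t j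
      - 3 * p.k / (4 * p.κ j) * r t j ^ 3 - net.ι j * Real.cos (θ t j - net.γ j)
      + ∑ l ∈ Finset.univ.erase j, net.g j l * r t l * Real.cos (θ t j - θ t l) := by
    rw [hA, ampField_eq net p (θ t) (hr j).ne']
    field_simp
  have hBj : 2 * p.C / p.κ j * (r t j * B j) = net.ι j * Real.sin (θ t j - net.γ j)
      - ∑ l ∈ Finset.univ.erase j, net.g j l * r t l * Real.sin (θ t j - θ t l) := by
    rw [hB, phaseField_eq net p (θ t) (hr j).ne']
    field_simp
  have hsum : ∑ l ∈ Finset.univ.erase j, D j l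
      = (∑ l ∈ Finset.univ.erase j, net.g j l * r t l * Real.cos (θ t j - θ t l)) * A j
        - (∑ l ∈ Finset.univ.erase j, net.g j l * r t l * Real.sin (θ t j - θ t l))
          * (r t j * B j) := by
    rw [Finset.sum_mul, Finset.sum_mul, ← Finset.sum_sub_distrib]
  rw [hsum]
  calc _ = -((2 * p.C / p.κ j * A j) * A j
          + (2 * p.C / p.κ j * (r t j * B j)) * (r t j * B j)) := by
        rw [hAj, hBj]; field_simp; ring
    _ = _ := by ring

theorem exists_potential_clampAmp_ge (net : Network N I) (p : Params N) :
    ∃ m, ∀ x : (N → ℝ) × (N → ℝ), m ≤ potential net p (clampAmp net p x.1) x.2 := by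
  have hρ := isBoundedLipschitz_clampAmp net p
  have h1 := IsBoundedLipschitz.sum Finset.univ fun j =>
    ((((hρ j).pow 4).const_mul (3 * p.k / (16 * p.κ j))).sub
      (((hρ j).pow 2).const_mul ((p.α - p.κ j * net.g j j) / (2 * p.κ j)))).add
      (((hρ j).const_mul (net.ι j)).mul
        (isBoundedLipschitz_cos_sub j _ (LipschitzWith.const (net.γ j))))
  have h2 := IsBoundedLipschitz.sum Finset.univ fun j =>
    IsBoundedLipschitz.sum (Finset.univ.erase j) fun l =>
      (((hρ j).const_mul (net.g j l)).mul (hρ l)).mul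
        (isBoundedLipschitz_cos_sub j _ (lipschitzWith_phase l))
  obtain ⟨⟨M, hM⟩, -⟩ := h1.sub (h2.const_mul (1 / 2))
  exact ⟨-M, fun x => (abs_le.1 (hM x)).1⟩

/-! ### Global existence and convergence -/

theorem rLow_half_le_and_le {net : Network N I} {p : Params N} {r : N → ℝ}
    (h : ∀ j, rLow net p j ≤ r j ∧ r j ≤ p.rOC) (j : N) :
    rLow net p j / 2 ≤ r j ∧ r j ≤ p.rOC + 1 := by
  have h0 : 0 ≤ rLow net p j := Real.sqrt_nonneg _
  constructor <;> linarith [(h j).1, (h j).2]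

/-- A trajectory of the truncated dynamics that starts in the box `[rLow, rOC]` stays there:
before the first time at which it leaves the larger box of `clampAmp` it solves the original
dynamics, and therefore it is still in the smaller closed box at that time. -/
theorem mem_box_of_hasDerivAt_clampedField {net : Network N I} {p : Params N}
    (hpos : ∀ j, p.κ j * net.g j j < p.α)
    (hkey : ∀ j, p.k * p.κ j ^ 2 *
        (net.ι j + p.rOC * ∑ l ∈ Finset.univ.erase j, net.g j l) ^ 2
      ≤ 16 / 81 * (p.α - p.κ j * net.g j j) ^ 3)
    {r₀ θ₀ : N → ℝ} (hr₀ : ∀ j, rLow net p j ≤ r₀ j ∧ r₀ j ≤ p.rOC)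
    (hup : ∀ T > 0, ∀ r θ : ℝ → N → ℝ, IsSolution net p (Ico 0 T) r θ →
      r 0 = r₀ → θ 0 = θ₀ → ∀ t ∈ Ico 0 T, ∀ j, r t j ≤ p.rOC)
    {x : ℝ → (N → ℝ) × (N → ℝ)} (hx0 : x 0 = (r₀, θ₀))
    (hx : ∀ t, HasDerivAt x (clampedField net p (x t)) t) :
    ∀ t, 0 ≤ t → ∀ j, rLow net p j ≤ (x t).1 j ∧ (x t).1 j ≤ p.rOC := by
  have hcont : Continuous x := continuous_iff_continuousAt.2 fun t => (hx t).continuousAt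
  have hcj : ∀ j, Continuous fun t => (x t).1 j := fun j =>
    (continuous_apply j).comp (continuous_fst.comp hcont)
  have hbox : ∀ T > 0,
      (∀ t ∈ Ico 0 T, ∀ j, rLow net p j / 2 ≤ (x t).1 j ∧ (x t).1 j ≤ p.rOC + 1) →
      ∀ t ∈ Icc 0 T, ∀ j, rLow net p j ≤ (x t).1 j ∧ (x t).1 j ≤ p.rOC := by
    intro T hT hfat t ht j
    have hsol := isSolution_of_hasDerivAt hx hfat
    have hle := hup T hT _ _ hsol (by rw [hx0]) (by rw [hx0])
    have hge := hsol.rLow_le hpos hkey (fun j => by rw [hx0]; exact (hr₀ j).1) hle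
    have hcl : IsClosed {t | rLow net p j ≤ (x t).1 j ∧ (x t).1 j ≤ p.rOC} :=
      (isClosed_le continuous_const (hcj j)).inter (isClosed_le (hcj j) continuous_const)
    have hsub : Ico 0 T ⊆ {t | rLow net p j ≤ (x t).1 j ∧ (x t).1 j ≤ p.rOC} :=
      fun s hs => ⟨hge s hs j, hle s hs j⟩
    rw [← closure_Ico hT.ne] at ht
    exact closure_minimal hsub hcl ht
  -- the exit times from the interior of the larger box
  let S : Set ℝ := {t | 0 ≤ t ∧ ∃ j, (x t).1 j ≤ rLow net p j / 2 ∨ p.rOC + 1 ≤ (x t).1 j}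
  have hS : S = ∅ := by
    by_contra hne
    have hSne : S.Nonempty := nonempty_iff_ne_empty.2 hne
    have hScl : IsClosed S := by
      have : S = Ici 0 ∩ ⋃ j, ({t | (x t).1 j ≤ rLow net p j / 2} ∪
          {t | p.rOC + 1 ≤ (x t).1 j}) := by
        ext t; simp [S]
      rw [this]
      exact isClosed_Ici.inter (isClosed_iUnion_of_finite fun j =>
        (isClosed_le (hcj j) continuous_const).union (isClosed_le continuous_const (hcj j)))
    have hSbdd : BddBelow S := ⟨0, fun t ht => ht.1⟩
    obtain ⟨hT0, j, hj⟩ := hScl.csInf_mem hSne hSbdd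
    set T := sInf S with hTdef
    have hin : ∀ j, rLow net p j ≤ (x T).1 j ∧ (x T).1 j ≤ p.rOC := by
      rcases hT0.eq_or_lt with h0 | h0
      · rw [← h0, hx0]; exact hr₀
      · refine hbox T h0 (fun t ht j => ?_) T (right_mem_Icc.2 hT0)
        by_contra hcon
        rw [not_and_or, not_le, not_le] at hcon
        exact (csInf_le hSbdd ⟨ht.1, j, hcon.imp le_of_lt le_of_lt⟩).not_gt ht.2
    have hL := rLow_pos net p j (hpos j)
    rcases hj with hj | hj
    · linarith [(hin j).1]
    · linarith [(hin j).2]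
  intro t ht
  refine hbox (t + 1) (by linarith) (fun s hs j => ?_) t ⟨ht, by linarith⟩
  by_contra hcon
  rw [not_and_or, not_le, not_le] at hcon
  exact eq_empty_iff_forall_notMem.1 hS s ⟨hs.1, j, hcon.imp le_of_lt le_of_lt⟩

/-- Along a trajectory that stays in the box, the potential decreases at a rate that controls the
squared velocities, so that all velocities tend to zero. -/
theorem tendsto_field_zero {net : Network N I} {p : Params N}
    (hpos : ∀ j, p.κ j * net.g j j < p.α) {x : ℝ → (N → ℝ) × (N → ℝ)}
    (hx : ∀ t, HasDerivAt x (clampedField net p (x t)) t)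
    (hbox : ∀ t, 0 ≤ t → ∀ j, rLow net p j ≤ (x t).1 j ∧ (x t).1 j ≤ p.rOC) :
    Tendsto (fun t => clampedField net p (x t)) atTop (𝓝 0) := by
  obtain ⟨M, K, hM, hK⟩ := exists_bound_lipschitzWith_clampedField net p hpos
  have hclamp : ∀ t, 0 ≤ t → clampAmp net p (x t).1 = (x t).1 := fun t ht =>
    clampAmp_eq net p (rLow_half_le_and_le (hbox t ht))
  have hxLip : LipschitzWith M x := lipschitzWith_of_nnnorm_deriv_le
    (fun t => (hx t).differentiableAt) fun t => by rw [(hx t).deriv]; exact hM _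
  have hvLip : ∀ s t, dist (clampedField net p (x s)) (clampedField net p (x t))
      ≤ (K * M : NNReal) * |s - t| := fun s t => (hK.comp hxLip).dist_le_mul s t
  have hr : ∀ t, 0 ≤ t → ∀ j, 0 < (x t).1 j := fun t ht j =>
    (rLow_pos net p j (hpos j)).trans_le (hbox t ht j).1
  obtain ⟨m, hm⟩ := exists_potential_clampAmp_ge net p
  have hV : ∀ t, 0 ≤ t → HasDerivAt (fun s => potential net p (x s).1 (x s).2)
      (-∑ j, 2 * p.C / p.κ j * ((clampedField net p (x t)).1 j ^ 2
        + ((x t).1 j * (clampedField net p (x t)).2 j) ^ 2)) t := by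
    intro t ht
    have h1 := hx t
    rw [clampedField, hclamp t ht] at h1 ⊢
    exact hasDerivAt_potential net p (r := fun s => (x s).1) (θ := fun s => (x s).2) (hr t ht)
      (hasDerivAt_pi.1 h1.fst) (hasDerivAt_pi.1 h1.snd)
  have hmV : ∀ t, 0 ≤ t → m ≤ potential net p (x t).1 (x t).2 := fun t ht => by
    have := hm (x t)
    rwa [hclamp t ht] at this
  have hcoef : ∀ j, 0 < 2 * p.C / p.κ j := fun j =>
    div_pos (mul_pos two_pos p.C_pos) (p.κ_pos j)
  have hterm : ∀ t j, 2 * p.C / p.κ j * ((clampedField net p (x t)).1 j ^ 2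
        + ((x t).1 j * (clampedField net p (x t)).2 j) ^ 2)
      ≤ ∑ j, 2 * p.C / p.κ j * ((clampedField net p (x t)).1 j ^ 2
        + ((x t).1 j * (clampedField net p (x t)).2 j) ^ 2) := fun t j =>
    Finset.single_le_sum (f := fun j => 2 * p.C / p.κ j * ((clampedField net p (x t)).1 j ^ 2
        + ((x t).1 j * (clampedField net p (x t)).2 j) ^ 2))
      (fun i _ => mul_nonneg (hcoef i).le (by positivity)) (Finset.mem_univ j)
  have hfst : ∀ j, Tendsto (fun t => (clampedField net p (x t)).1 j) atTop (𝓝 0) := fun j => by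
    refine tendsto_zero_of_deriv_le_neg_sq (hcoef j) hV (fun t ht => ?_) hmV
      (K := (K * M : NNReal)) fun s t _ _ => ?_
    · have h2 := mul_nonneg (hcoef j).le (sq_nonneg ((x t).1 j * (clampedField net p (x t)).2 j))
      linarith [hterm t j]
    · rw [← Real.dist_eq]
      exact ((dist_le_pi_dist _ _ j).trans (le_max_left _ _)).trans (hvLip s t)
  have hsnd : ∀ j, Tendsto (fun t => (clampedField net p (x t)).2 j) atTop (𝓝 0) := fun j => by
    have hL := rLow_pos net p j (hpos j)
    refine tendsto_zero_of_deriv_le_neg_sq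
      (mul_pos (hcoef j) (pow_pos hL 2)) hV (fun t ht => ?_) hmV
      (K := (K * M : NNReal)) fun s t _ _ => ?_
    · have h1 := mul_nonneg (hcoef j).le (sq_nonneg ((clampedField net p (x t)).1 j))
      have h2 : rLow net p j ^ 2 * (clampedField net p (x t)).2 j ^ 2
          ≤ ((x t).1 j * (clampedField net p (x t)).2 j) ^ 2 := by
        rw [mul_pow]
        exact mul_le_mul_of_nonneg_right (pow_le_pow_left₀ hL.le (hbox t ht j).1 2) (sq_nonneg _)
      have h3 := mul_le_mul_of_nonneg_left h2 (hcoef j).le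
      linarith [hterm t j]
    · rw [← Real.dist_eq]
      exact ((dist_le_pi_dist _ _ j).trans (le_max_right _ _)).trans (hvLip s t)
  exact (tendsto_pi_nhds.2 hfst).prodMk_nhds (tendsto_pi_nhds.2 hsnd)

/-- Translating the phases by multiples of `2π` preserves the set of equilibria. -/
theorem mem_equilibria_add_two_pi {net : Network N I} {p : Params N} {r θ : N → ℝ} (n : N → ℤ)
    (h : (r, θ) ∈ equilibria net p) :
    (r, fun j => θ j + n j * (2 * Real.pi)) ∈ equilibria net p := by
  have hshift : (fun j => θ j + n j * (2 * Real.pi) - n j * (2 * Real.pi)) = θ := by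
    ext j; ring
  have hA := ampField_periodic net p r (fun j => θ j + n j * (2 * Real.pi)) n
  have hB := phaseField_periodic net p r (fun j => θ j + n j * (2 * Real.pi)) n
  refine ⟨h.1, fun j => ?_⟩
  simp only at hA hB ⊢
  rw [← hA, ← hB, hshift]
  exact h.2 j

/-- Modulo `2π` in the phases, the trajectory lies in a compact set, and its accumulation points
are equilibria because the velocities tend to zero. -/
theorem exists_subseq_tendsto_infDist {net : Network N I} {p : Params N}
    (hpos : ∀ j, p.κ j * net.g j j < p.α) {x : ℝ → (N → ℝ) × (N → ℝ)}
    (hbox : ∀ t, 0 ≤ t → ∀ j, rLow net p j ≤ (x t).1 j ∧ (x t).1 j ≤ p.rOC)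
    (hlim : Tendsto (fun t => clampedField net p (x t)) atTop (𝓝 0))
    {τ : ℕ → ℝ} (hτ : Tendsto τ atTop atTop) :
    (equilibria net p).Nonempty ∧ ∃ φ : ℕ → ℕ,
      Tendsto (fun n => Metric.infDist (x (τ (φ n))) (equilibria net p)) atTop (𝓝 0) := by
  obtain ⟨M, K, -, hK⟩ := exists_bound_lipschitzWith_clampedField net p hpos
  have h2π : 0 < 2 * Real.pi := by positivity
  let n : ℝ → N → ℤ := fun t j => ⌊(x t).2 j / (2 * Real.pi)⌋
  let y : ℝ → (N → ℝ) × (N → ℝ) := fun t =>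
    ((x t).1, fun j => (x t).2 j - n t j * (2 * Real.pi))
  have hyv : ∀ t, clampedField net p (y t) = clampedField net p (x t) := fun t => by
    simp only [clampedField, y, ampField_periodic, phaseField_periodic]
  have hcompact : IsCompact (Icc (rLow net p) (fun _ => p.rOC) ×ˢ
      Icc (0 : N → ℝ) (fun _ => 2 * Real.pi)) := isCompact_Icc.prod isCompact_Icc
  have hy : ∀ t, 0 ≤ t → y t ∈ Icc (rLow net p) (fun _ => p.rOC) ×ˢ
      Icc (0 : N → ℝ) (fun _ => 2 * Real.pi) := by
    refine fun t ht => ⟨⟨fun j => (hbox t ht j).1, fun j => (hbox t ht j).2⟩, fun j => ?_,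
      fun j => ?_⟩
    · have := (le_div_iff₀ h2π).1 (Int.floor_le ((x t).2 j / (2 * Real.pi)))
      simpa [y, n] using this
    · have := (div_lt_iff₀ h2π).1 (Int.lt_floor_add_one ((x t).2 j / (2 * Real.pi)))
      simp only [y, n]
      linarith
  obtain ⟨z, hz, φ, hφ, hφz⟩ := hcompact.tendsto_subseq' (x := fun k => y (τ k))
    ((hτ.eventually_ge_atTop 0).mono fun k hk => hy (τ k) hk).frequently
  have hτφ := hτ.comp hφ.tendsto_atTop
  have hz0 : clampedField net p z = 0 := by
    refine tendsto_nhds_unique ((hK.continuous.tendsto z).comp hφz) ?_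
    refine (hlim.comp hτφ).congr fun k => ?_
    exact (hyv _).symm
  have hzbox : ∀ j, rLow net p j ≤ z.1 j ∧ z.1 j ≤ p.rOC := fun j => ⟨hz.1.1 j, hz.1.2 j⟩
  have hzE : z ∈ equilibria net p := by
    rw [clampedField, clampAmp_eq net p (rLow_half_le_and_le hzbox), Prod.mk_eq_zero] at hz0
    exact ⟨hzbox, fun j => ⟨congrFun hz0.1 j, congrFun hz0.2 j⟩⟩
  refine ⟨⟨z, hzE⟩, φ, ?_⟩
  refine squeeze_zero (fun _ => Metric.infDist_nonneg) (fun k => ?_)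
    (tendsto_iff_dist_tendsto_zero.1 hφz)
  refine (Metric.infDist_le_dist_of_mem
    (mem_equilibria_add_two_pi (n (τ (φ k))) hzE)).trans_eq ?_
  rw [Function.comp_apply, dist_eq_norm, dist_eq_norm]
  congr 1
  ext j
  · rfl
  · simp only [y, Prod.snd_sub, Pi.sub_apply]
    ring

end VOC

theorem theorem2 {N I : Type*} [Fintype N] [Fintype I] [DecidableEq N] [DecidableEq I]
    (net : VOC.Network N I) (p : VOC.Params N)
    (hpos : ∀ j, p.κ j * net.g j j < p.α)
    (hkey : ∀ j, p.k * p.κ j ^ 2 *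
        (net.ι j + p.rOC * ∑ l ∈ Finset.univ.erase j, net.g j l) ^ 2
      ≤ 16 / 81 * (p.α - p.κ j * net.g j j) ^ 3)
    (r₀ θ₀ : N → ℝ)
    (hr₀ : ∀ j, VOC.rLow net p j ≤ r₀ j ∧ r₀ j ≤ p.rOC)
    -- the amplitudes do not exceed the open-circuit voltage, as long as the solution exists
    (hup : ∀ T > 0, ∀ r θ : ℝ → N → ℝ, VOC.IsSolution net p (Set.Ico 0 T) r θ →
      r 0 = r₀ → θ 0 = θ₀ → ∀ t ∈ Set.Ico 0 T, ∀ j, r t j ≤ p.rOC) :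
    ∃ r θ : ℝ → N → ℝ,
      -- there is a solution for all times, and no other one
      VOC.IsSolution net p (Set.Ici 0) r θ ∧ r 0 = r₀ ∧ θ 0 = θ₀ ∧
      (∀ T > 0, ∀ r' θ' : ℝ → N → ℝ, VOC.IsSolution net p (Set.Ico 0 T) r' θ' →
        r' 0 = r₀ → θ' 0 = θ₀ → ∀ t ∈ Set.Ico 0 T, r' t = r t ∧ θ' t = θ t) ∧
      -- the amplitudes stay above the positive lower bounds
      (∀ t, 0 ≤ t → ∀ j, 0 < VOC.rLow net p j ∧ VOC.rLow net p j ≤ r t j) ∧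
      -- the solution converges to the nonempty set of equilibria
      (VOC.equilibria net p).Nonempty ∧
      Filter.Tendsto (fun t => Metric.infDist (r t, θ t) (VOC.equilibria net p))
        Filter.atTop (𝓝 0) := by
  obtain ⟨M, K, hM, hK⟩ := VOC.exists_bound_lipschitzWith_clampedField net p hpos
  obtain ⟨x, hx0, hx⟩ := exists_forall_hasDerivAt_of_bounded_lipschitz hM hK (r₀, θ₀)
  have hbox := VOC.mem_box_of_hasDerivAt_clampedField hpos hkey hr₀ hup hx0 hx
  have hlim := VOC.tendsto_field_zero hpos hx hbox
  refine ⟨fun t => (x t).1, fun t => (x t).2,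
    VOC.isSolution_of_hasDerivAt hx fun t ht => VOC.rLow_half_le_and_le (hbox t ht),
    by simp only [hx0], by simp only [hx0], ?_,
    fun t ht j => ⟨VOC.rLow_pos net p j (hpos j), (hbox t ht j).1⟩,
    (VOC.exists_subseq_tendsto_infDist hpos hbox hlim tendsto_natCast_atTop_atTop).1,
    tendsto_of_subseq_tendsto fun τ hτ =>
      (VOC.exists_subseq_tendsto_infDist hpos hbox hlim hτ).2⟩
  -- Any other solution stays in the box as well, so that it solves the truncated dynamics.
  intro T hT r' θ' hsol hr' hθ' t ht
  have hle := hup T hT r' θ' hsol hr' hθ'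
  have hge := hsol.rLow_le hpos hkey (fun j => by rw [hr']; exact (hr₀ j).1) hle
  have hder : ∀ s ∈ Ico 0 T, HasDerivWithinAt (fun s => (r' s, θ' s))
      (VOC.clampedField net p (r' s, θ' s)) (Ico 0 T) s := fun s hs =>
    hsol.hasDerivWithinAt hs (VOC.rLow_half_le_and_le fun j => ⟨hge s hs j, hle s hs j⟩)
  have hsub : Icc 0 t ⊆ Ico 0 T := fun s hs => ⟨hs.1, hs.2.trans_lt ht.2⟩
  have heq := ODE_solution_unique (v := fun _ => VOC.clampedField net p) (a := 0) (b := t)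
    (f := fun s => (r' s, θ' s)) (g := x) (fun _ => hK)
    (fun s hs => ((hder s (hsub hs)).mono hsub).continuousWithinAt)
    (fun s hs => (hder s (hsub (Ico_subset_Icc_self hs))).mono_of_mem_nhdsWithin
      (mem_of_superset (Ico_mem_nhdsGE (hs.2.trans ht.2)) (Ico_subset_Ico_left hs.1)))
    (fun s _ => (hx s).continuousAt.continuousWithinAt)
    (fun s _ => (hx s).hasDerivWithinAt) (by simp only [hr', hθ', hx0]) (right_mem_Icc.2 ht.1)
  exact ⟨congrArg Prod.fst heq, congrArg Prod.snd heq⟩
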